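/- **Theorem 3.1.** Let $d\ge 1$ and let $H(\mathbb C^d)$ be the space of entire functions on $\mathbb C^d$ with the topology of uniform convergence on compact sets. For a compact set $K\subset\mathbb C^d$ write $|f|_K=\sup_{z\in K}|f(z)|$ (with $|f|_\emptyset=0$). Let $(\varphi_n)_{n=0}^\infty$ be a basis of $H(\mathbb C^d)$, that is, a sequence of entire functions such that for every $f\in H(\mathbb C^d)$ there is a unique sequence of complex numbers $(f_n)_{n=0}^\infty$ with $f=\sum_{n=0}^\infty f_n\varphi_n$, the series converging uniformly on every compact subset of $\mathbb C^d$. Then the following are equivalent: 1. $(\varphi_n)$ has the Global Bohr Property: for every compact $K\subset\mathbb C^d$ there is a compact $K_1\supset K$ such that for every $f=\sum_{n=0}^\infty f_n\varphi_n\in H(\mathbb C^d)$ the series on the left below converges and $$\sum_{n=0}^\infty |f_n|\,|\varphi_n|_K\le |f|_{K_1}.$$ 2. One of the functions $\varphi_n$ is constant. -/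

import Mathlib

open Filter

namespace EntireBasis

/-- Complex-valued functions on `ℂ^d`. Compactness and holomorphy do not depend on the norm chosen on `ℂ^d`. -/
abbrev Fn (d : ℕ) : Type := EuclideanSpace ℂ (Fin d) → ℂ

/-- `f` is an entire function on `ℂ^d`, that is, an element of the space `H(ℂ^d)`. -/
def IsEntire {d : ℕ} (f : Fn d) : Prop := Differentiable ℂ f

/-- `|f|_K`, the supremum of `|f z|` over `z ∈ K`. It is only used for `f` continuous and `K` compact,
so the supremum is over a bounded set; for `K` empty it is `0`. -/
noncomputable def supOn {d : ℕ} (K : Set (EuclideanSpace ℂ (Fin d))) (f : Fn d) : ℝ :=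
  ⨆ z : K, ‖f z‖

/-- `f = ∑_{n=0}^∞ c n • φ n`, the partial sums converging to `f` uniformly on every compact set
(that is, in the topology of the Fréchet space `H(ℂ^d)`). -/
def HasExpansion {d : ℕ} (φ : ℕ → Fn d) (c : ℕ → ℂ) (f : Fn d) : Prop :=
  ∀ K : Set (EuclideanSpace ℂ (Fin d)), IsCompact K →
    TendstoUniformlyOn (fun N z => ∑ n ∈ Finset.range N, c n * φ n z) f atTop K

/-- `φ` is a basis of `H(ℂ^d)`: its members are entire functions, and every entire function has exactly
one expansion in `φ` that converges uniformly on compact sets. -/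
structure IsBasis {d : ℕ} (φ : ℕ → Fn d) : Prop where
  entire : ∀ n, IsEntire (φ n)
  existsUnique_expansion : ∀ f : Fn d, IsEntire f → ∃! c : ℕ → ℂ, HasExpansion φ c f

/-- The Global Bohr Property of `φ`. The series on the left of the inequality has nonnegative terms;
its convergence is part of the inequality. -/
def GlobalBohrProperty {d : ℕ} (φ : ℕ → Fn d) : Prop :=
  ∀ K : Set (EuclideanSpace ℂ (Fin d)), IsCompact K →
    ∃ K₁ : Set (EuclideanSpace ℂ (Fin d)), IsCompact K₁ ∧ K ⊆ K₁ ∧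
      ∀ (f : Fn d) (c : ℕ → ℂ), IsEntire f → HasExpansion φ c f →
        Summable (fun n => ‖c n‖ * supOn K (φ n)) ∧
          ∑' n, ‖c n‖ * supOn K (φ n) ≤ supOn K₁ f

end EntireBasis

/-! Property implies constant: expand `1 = ∑ c n φ n`. On `K = {0, z}` the Bohr inequality bounds `∑
|c n| |φ n|_K` by `1`, so the triangle inequality is an equality and each `c n φ n` takes the same
value at `0` and at `z`. Any `n` with `c n ≠ 0` then gives a constant `φ n`.

Constant implies property: every basis is absolute, so `∑ |f n| |φ n|_R ≤ C |f|_b`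
(`IsBasis.exists_summable_tsum_le`). Apply this to `f - f 0`, whose expansion differs from that of
`f` only at the constant basis element. Borel–Carathéodory on a huge ball of radius `S` gives `|f -
f 0|_b ≤ (|f|_S - |f 0|) / C`, and restoring the constant costs exactly the missing `|f 0|`.

Absoluteness has two ingredients. Baire category and successive approximation make the partial sum
operators equicontinuous, hence `|f n| |φ n|_R ≤ C |f|_a`. Nuclearity makes `|φ n|_R / |φ n|_R'`
summable for large `R'`: if too many ratios were large, a combination of those `φ n` vanishing to
high order at `0` would, by Schwarz, be too small on the ball of radius `a` for its coefficients. -/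

open Metric Topology Asymptotics

/-! ### Schwarz estimates, limits and derivatives of holomorphic functions -/

/-- Second-order Schwarz estimate. -/
theorem norm_sub_sub_fderiv_le {E : Type*} [NormedAddCommGroup E] [NormedSpace ℂ E]
    {f : E → ℂ} {z : E} {M : ℝ} (hf : DifferentiableOn ℂ f (ball z 1))
    (hM : ∀ w ∈ ball z 1, ‖f w‖ ≤ M) {w : E} (hw : w ∈ ball z 1) :
    ‖f w - f z - fderiv ℂ f z (w - z)‖ ≤ 4 * M * ‖w - z‖ ^ 2 := by
  have hz : z ∈ ball z (1 : ℝ) := mem_ball_self one_pos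
  have hfz : DifferentiableAt ℂ f z := hf.differentiableAt (ball_mem_nhds z one_pos)
  have hdist : ∀ u ∈ ball z 1, ‖f u - f z‖ ≤ 2 * M := fun u hu => by
    linarith [norm_sub_le (f u) (f z), hM u hu, hM z hz]
  have hD : ‖fderiv ℂ f z‖ ≤ 2 * M := by
    have := Complex.norm_fderiv_le_div_of_mapsTo_ball (R₂ := 2 * M) hf
      (fun u hu => by simpa [dist_eq_norm] using hdist u hu) one_pos
    simpa using this
  -- Subtracting the linear part leaves a function that differs from its value at `z` by `o(‖u -
  -- z‖)` and by at most `2M + 2M` on the ball, so the Schwarz lemma gives a quadratic bound.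
  have key := Complex.dist_le_mul_div_pow_of_mapsTo_ball_of_isLittleO (n := 1)
    (f := fun u => f u - fderiv ℂ f z (u - z)) (c := z) (R₁ := 1) (R₂ := 4 * M)
    (hf.sub (by fun_prop)) ?_ ?_ hw
  · simpa [dist_eq_norm, sub_right_comm] using key
  · intro u hu
    have h1 : ‖fderiv ℂ f z (u - z)‖ ≤ 2 * M := by
      refine (ContinuousLinearMap.le_opNorm _ _).trans ?_
      have : ‖u - z‖ ≤ 1 := by simpa [dist_eq_norm] using (mem_ball.1 hu).le
      nlinarith [norm_nonneg (fderiv ℂ f z), norm_nonneg (u - z)]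
    have h2 := norm_sub_le (f u - f z) (fderiv ℂ f z (u - z))
    have h3 := hdist u hu
    simp only [mem_closedBall, dist_eq_norm, sub_self, map_zero, sub_zero]
    rw [sub_right_comm]
    linarith
  · have := hfz.hasFDerivAt.isLittleO
    simp only [sub_self, map_zero, sub_zero, pow_one]
    refine (this.norm_right).congr_left fun u => ?_
    ring

/-- A pointwise limit of holomorphic functions that are bounded near `z` is differentiable at `z`. -/
theorem differentiableAt_of_tendsto_of_bounded {E : Type*} [NormedAddCommGroup E]
    [NormedSpace ℂ E] [FiniteDimensional ℂ E] {F : ℕ → E → ℂ} {f : E → ℂ} {z : E} {M : ℝ}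
    (hF : ∀ n, Differentiable ℂ (F n)) (hM : ∀ᶠ n in atTop, ∀ w ∈ ball z 1, ‖F n w‖ ≤ M)
    (hlim : ∀ w, Tendsto (fun n => F n w) atTop (𝓝 (f w))) : DifferentiableAt ℂ f z := by
  obtain ⟨n₀, hn₀⟩ := eventually_atTop.1 hM
  have hz : z ∈ ball z (1 : ℝ) := mem_ball_self one_pos
  -- The derivatives at `z` stay in a compact ball of the dual. The quadratic bound survives along a
  -- convergent subsequence, so its limit `L` is the derivative of `f`.
  have hb : ∀ n, fderiv ℂ (F (n + n₀)) z ∈ closedBall (0 : E →L[ℂ] ℂ) (2 * M) := fun n => by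
    have := Complex.norm_fderiv_le_div_of_mapsTo_ball (c := z) (R₁ := 1) (R₂ := 2 * M)
      (hF (n + n₀)).differentiableOn
      (fun u hu => by
        have h1 := hn₀ (n + n₀) (by omega) u hu
        have h2 := hn₀ (n + n₀) (by omega) z hz
        rw [mem_closedBall, dist_eq_norm]
        linarith [norm_sub_le (F (n + n₀) u) (F (n + n₀) z)]) one_pos
    simpa using this
  have : ProperSpace (E →L[ℂ] ℂ) := FiniteDimensional.proper ℂ _
  obtain ⟨L, -, ψ, hψ, hL⟩ := (isCompact_closedBall (0 : E →L[ℂ] ℂ) (2 * M)).tendsto_subseq hb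
  have hψ' : Tendsto (fun n => ψ n + n₀) atTop atTop :=
    (tendsto_add_atTop_nat n₀).comp hψ.tendsto_atTop
  have hquad : ∀ w ∈ ball z 1, ‖f w - f z - L (w - z)‖ ≤ 4 * M * ‖w - z‖ ^ 2 := by
    intro w hw
    have hlim' : Tendsto (fun n => ‖F (ψ n + n₀) w - F (ψ n + n₀) z
        - fderiv ℂ (F (ψ n + n₀)) z (w - z)‖) atTop (𝓝 ‖f w - f z - L (w - z)‖) := by
      refine ((((hlim w).comp hψ').sub ((hlim z).comp hψ')).sub ?_).norm
      exact ((ContinuousLinearMap.apply ℂ ℂ (w - z)).continuous.tendsto L).comp hL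
    refine le_of_tendsto' hlim' fun n => ?_
    exact norm_sub_sub_fderiv_le (hF _).differentiableOn (hn₀ _ (by omega)) hw
  refine (HasFDerivAt.of_isLittleO (f' := L) ?_).differentiableAt
  have hO : (fun w => f w - f z - L (w - z)) =O[𝓝 z] fun w => ‖w - z‖ ^ 2 := by
    refine IsBigO.of_bound (4 * M) ?_
    filter_upwards [ball_mem_nhds z one_pos] with w hw
    simpa using hquad w hw
  refine hO.trans_isLittleO ?_
  refine IsLittleO.of_norm_right ?_
  have h0 : Tendsto (fun w => ‖w - z‖) (𝓝 z) (𝓝 0) := by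
    have : Continuous fun w => ‖w - z‖ := by fun_prop
    simpa using this.tendsto z
  have := (isLittleO_pow_id (𝕜 := ℝ) one_lt_two).comp_tendsto h0
  simpa [Function.comp_def] using this

/-- Directional derivatives of entire functions are entire. -/
theorem Differentiable.fderiv_apply_const {E : Type*} [NormedAddCommGroup E]
    [NormedSpace ℂ E] [FiniteDimensional ℂ E] {f : E → ℂ} (hf : Differentiable ℂ f) (v : E) :
    Differentiable ℂ fun z => fderiv ℂ f z v := by
  intro z
  have : ProperSpace E := FiniteDimensional.proper ℂ E
  obtain ⟨M, hM⟩ := (isCompact_closedBall z 3).exists_bound_of_continuousOn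
    hf.continuous.continuousOn
  have hn0 : Tendsto (fun n : ℕ => (n : ℝ)⁻¹ * ‖v‖) atTop (𝓝 0) := by
    simpa using tendsto_inv_atTop_nhds_zero_nat.mul_const ‖v‖
  -- Difference quotients of step `v / n` converge to the directional derivative; Schwarz bounds
  -- them near `z` once `‖v‖ / n < 1`.
  refine differentiableAt_of_tendsto_of_bounded (M := 2 * M * ‖v‖)
    (F := fun n w => (n : ℂ) * (f (w + (n : ℂ)⁻¹ • v) - f w)) (fun n => by fun_prop) ?_ ?_
  · filter_upwards [hn0.eventually (gt_mem_nhds one_pos), eventually_ge_atTop 1] with n hn hn1 w hw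
    have hnpos : (0 : ℝ) < n := by exact_mod_cast hn1
    have hu : w + (n : ℂ)⁻¹ • v ∈ ball w 1 := by simpa [norm_smul] using hn
    have hw3 : ∀ u ∈ ball w 1, ‖f u‖ ≤ M := fun u hu => hM u <| by
      have := dist_triangle u w z
      rw [mem_ball] at hu hw
      rw [mem_closedBall]; linarith
    have := Complex.dist_le_div_mul_dist_of_mapsTo_ball (f := f) (c := w) (R₁ := 1) (R₂ := 2 * M)
      hf.differentiableOn (fun u hu => by
        have h1 := hw3 u hu
        have h2 := hw3 w (mem_ball_self one_pos)
        rw [mem_closedBall, dist_eq_norm]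
        linarith [norm_sub_le (f u) (f w)]) hu
    rw [dist_eq_norm, dist_eq_norm, add_sub_cancel_left, norm_smul, norm_inv, Complex.norm_natCast,
      div_one] at this
    rw [norm_mul, Complex.norm_natCast]
    calc (n : ℝ) * ‖f (w + (n : ℂ)⁻¹ • v) - f w‖ ≤ n * (2 * M * ((n : ℝ)⁻¹ * ‖v‖)) := by gcongr
      _ = 2 * M * ‖v‖ := by field_simp
  · intro w
    have := (hf w).hasFDerivAt.lim v (c := fun n : ℕ => (n : ℂ)) (l := atTop) ?_
    · simpa using this
    · simpa using tendsto_natCast_atTop_atTop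

/-- If all first-order derivatives are `o(‖z‖ ^ n)` then a function vanishing at `0` is
`o(‖z‖ ^ (n + 1))`. -/
theorem isLittleO_pow_succ_of_fderiv {E : Type*} [NormedAddCommGroup E] [NormedSpace ℂ E]
    {f : E → ℂ} {n : ℕ} (hf : Differentiable ℂ f) (h0 : f 0 = 0)
    (h : fderiv ℂ f =o[𝓝 0] fun z => ‖z‖ ^ n) : f =o[𝓝 0] fun z => ‖z‖ ^ (n + 1) := by
  refine IsLittleO.of_bound fun c hc => ?_
  obtain ⟨r, hr, hb⟩ := Metric.eventually_nhds_iff_ball.1 (h.bound hc)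
  filter_upwards [ball_mem_nhds 0 hr] with z hz
  let _ : NormedSpace ℝ E := NormedSpace.restrictScalars ℝ ℂ E
  have hs : ∀ u ∈ closedBall (0 : E) ‖z‖, ‖fderiv ℂ f u‖ ≤ c * ‖z‖ ^ n := fun u hu => by
    have hu' : ‖u‖ ≤ ‖z‖ := by simpa using hu
    have := hb u (by simpa using hu'.trans_lt (by simpa using hz))
    rw [norm_pow, norm_norm] at this
    exact this.trans (by gcongr)
  have := (convex_closedBall (0 : E) ‖z‖).norm_image_sub_le_of_norm_fderiv_le (𝕜 := ℂ)
    (fun u _ => hf u) hs (x := 0) (y := z) (by simp) (by simp)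
  rw [h0, sub_zero, sub_zero] at this
  rw [norm_pow, norm_norm, pow_succ]
  linarith

/-- An entire function of order `o(‖z‖ ^ n)` at `0` is small near `0`. -/
theorem norm_le_mul_div_pow_of_isLittleO {E : Type*} [NormedAddCommGroup E] [NormedSpace ℂ E]
    {f : E → ℂ} {n : ℕ} (hf : Differentiable ℂ f) (h0 : f 0 = 0)
    (h : f =o[𝓝 0] fun z => ‖z‖ ^ n) {R M : ℝ} (hM : ∀ z ∈ closedBall 0 R, ‖f z‖ ≤ M)
    {z : E} (hz : ‖z‖ < R) : ‖f z‖ ≤ M * (‖z‖ / R) ^ (n + 1) := by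
  have := Complex.dist_le_mul_div_pow_of_mapsTo_ball_of_isLittleO (n := n) (f := f) (c := 0)
    (R₁ := R) (R₂ := M) hf.differentiableOn
    (fun u hu => by simpa [h0] using hM u (ball_subset_closedBall hu)) (by simpa [h0] using h)
    (z := z) (by simpa using hz)
  simpa [h0] using this

namespace EntireBasis

/-! ### The space of entire functions and vanishing order at the origin -/

/-- The space `H(ℂ^d)`, as a subspace of the continuous functions with the compact-open topology. -/
def Entire (d : ℕ) : Submodule ℂ C(EuclideanSpace ℂ (Fin d), ℂ) where
  carrier := {f | Differentiable ℂ f}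
  add_mem' hf hg := hf.add hg
  zero_mem' := differentiable_const 0
  smul_mem' c _ hf := hf.const_smul c

variable {d : ℕ}

/-- An entire function as an element of `Entire d`. -/
def IsEntire.toEntire {f : Fn d} (hf : IsEntire f) : Entire d :=
  ⟨⟨f, hf.continuous⟩, hf⟩

theorem Entire.isEntire (f : Entire d) : IsEntire f.1 := f.2

/-- The `i`-th partial derivative on `H(ℂ^d)`. -/
noncomputable def partialDeriv (i : Fin d) : Entire d →ₗ[ℂ] Entire d where
  toFun f := IsEntire.toEntire (f := fun z => fderiv ℂ f.1 z (EuclideanSpace.single i 1))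
    (Differentiable.fderiv_apply_const f.2 _)
  map_add' f g := by
    ext z
    change fderiv ℂ (⇑f.1 + ⇑g.1) z _ = fderiv ℂ f.1 z _ + fderiv ℂ g.1 z _
    rw [fderiv_add (f.2 z) (g.2 z), add_apply]
  map_smul' c f := by
    ext z
    change fderiv ℂ (c • ⇑f.1) z _ = c * fderiv ℂ f.1 z _
    rw [fderiv_const_smul (f.2 z), smul_apply, smul_eq_mul]

theorem partialDeriv_apply (i : Fin d) (f : Entire d) (z : EuclideanSpace ℂ (Fin d)) :
    (partialDeriv i f).1 z = fderiv ℂ f.1 z (EuclideanSpace.single i 1) := rfl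

theorem norm_fderiv_le_sum_partialDeriv (f : Entire d) (z : EuclideanSpace ℂ (Fin d)) :
    ‖fderiv ℂ f.1 z‖ ≤ ∑ i, ‖(partialDeriv i f).1 z‖ := by
  refine ContinuousLinearMap.opNorm_le_bound _ (Finset.sum_nonneg fun _ _ => norm_nonneg _)
    fun v => ?_
  have hv : v = ∑ i, v i • EuclideanSpace.single i (1 : ℂ) := by
    simpa using ((EuclideanSpace.basisFun (Fin d) ℂ).sum_repr v).symm
  conv_lhs => rw [hv, map_sum]
  rw [Finset.sum_mul]
  refine norm_sum_le_of_le _ fun i _ => ?_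
  rw [map_smul, norm_smul, mul_comm, partialDeriv_apply]
  gcongr
  exact PiLp.norm_apply_le v i

/-- Vanishing of at most `(d + 1) ^ n` linear functionals forces vanishing of order `n` at `0`. -/
theorem exists_functionals_isLittleO (d n : ℕ) :
    ∃ (ι : Type) (_ : Fintype ι) (T : Entire d →ₗ[ℂ] ι → ℂ), Fintype.card ι ≤ (d + 1) ^ n ∧
      ∀ f, T f = 0 → f.1 0 = 0 ∧ ⇑f.1 =o[𝓝 0] fun z => ‖z‖ ^ n := by
  induction n with
  | zero =>
    refine ⟨Unit, inferInstance,
      LinearMap.pi fun _ => { toFun f := f.1 0, map_add' _ _ := rfl, map_smul' _ _ := rfl },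
      by simp, fun f hf => ?_⟩
    have h0 : f.1 0 = 0 := congrFun hf ()
    refine ⟨h0, ?_⟩
    have := f.1.continuous.tendsto 0
    rw [h0] at this
    simpa using this
  | succ n ih =>
    obtain ⟨ι, _, T, hcard, hT⟩ := ih
    -- The value at `0`, together with the previous functionals applied to each partial derivative:
    -- `1 + d (d + 1) ^ n ≤ (d + 1) ^ (n + 1)` in all. Repeated mixed partials do no harm.
    refine ⟨Unit ⊕ Fin d × ι, inferInstance,
      LinearMap.pi (Sum.elim
        (fun _ => { toFun f := f.1 0, map_add' _ _ := rfl, map_smul' _ _ := rfl })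
        fun p => (LinearMap.proj p.2).comp (T.comp (partialDeriv p.1))), ?_, fun f hf => ?_⟩
    · simp only [Fintype.card_sum, Fintype.card_unit, Fintype.card_prod, Fintype.card_fin]
      have : 1 ≤ (d + 1) ^ n := Nat.one_le_pow _ _ (by omega)
      rw [pow_succ]
      nlinarith [Nat.mul_le_mul_left d hcard]
    · have h0 : f.1 0 = 0 := congrFun hf (Sum.inl ())
      refine ⟨h0, isLittleO_pow_succ_of_fderiv f.2 h0 ?_⟩
      have hp : ∀ i, ⇑(partialDeriv i f).1 =o[𝓝 0] fun z => ‖z‖ ^ n := fun i =>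
        (hT (partialDeriv i f) (funext fun j => congrFun hf (Sum.inr (i, j)))).2
      refine IsBigO.trans_isLittleO (g := fun z => ∑ i, ‖(partialDeriv i f).1 z‖) ?_
        (IsLittleO.fun_sum fun i _ => (hp i).norm_left)
      refine IsBigO.of_bound 1 (Eventually.of_forall fun z => ?_)
      rw [one_mul]
      exact (norm_fderiv_le_sum_partialDeriv f z).trans (Real.le_norm_self _)

/-- Among more than `(d + 1) ^ n` entire functions there is a nontrivial combination that is small
near the origin compared with its size on a large ball. -/
theorem exists_combination_small {n : ℕ} (F : Finset ℕ) (hF : (d + 1) ^ n < F.card)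
    (φ : ℕ → Entire d) :
    ∃ x : ℕ → ℂ, (∃ m ∈ F, x m ≠ 0) ∧ ∀ R M : ℝ,
      (∀ z ∈ closedBall 0 R, ‖(∑ m ∈ F, x m • φ m).1 z‖ ≤ M) → ∀ z, ‖z‖ < R →
        ‖(∑ m ∈ F, x m • φ m).1 z‖ ≤ M * (‖z‖ / R) ^ (n + 1) := by
  obtain ⟨ι, _, T, hcard, hT⟩ := exists_functionals_isLittleO d n
  let A : (F → ℂ) →ₗ[ℂ] ι → ℂ := T.comp (Fintype.linearCombination ℂ fun m : F => φ m)
  have hker : LinearMap.ker A ≠ ⊥ := LinearMap.ker_ne_bot_of_finrank_lt <| by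
    simp only [Module.finrank_fintype_fun_eq_card, Fintype.card_coe]
    omega
  obtain ⟨x, hx, hx0⟩ := (Submodule.ne_bot_iff _).1 hker
  obtain ⟨⟨m, hm⟩, hxm⟩ := Function.ne_iff.1 hx0
  have hsum : ∑ m ∈ F, (fun m => if h : m ∈ F then x ⟨m, h⟩ else 0) m • φ m
      = Fintype.linearCombination ℂ (fun m : F => φ m) x := by
    rw [Fintype.linearCombination_apply, ← Finset.sum_coe_sort]
    exact Finset.sum_congr rfl fun i _ => by simp
  refine ⟨fun m => if h : m ∈ F then x ⟨m, h⟩ else 0, ⟨m, hm, by simpa [hm] using hxm⟩, ?_⟩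
  rw [hsum]
  intro R M hM z hz
  have hTx := hT _ (LinearMap.mem_ker.1 hx)
  exact norm_le_mul_div_pow_of_isLittleO (Entire.isEntire _) hTx.1 hTx.2 hM hz

/-! ### Fréchet topology of the space of entire functions -/

theorem isClosed_entire (d : ℕ) :
    IsClosed (Entire d : Set C(EuclideanSpace ℂ (Fin d), ℂ)) := by
  refine IsSeqClosed.isClosed fun F f hF hlim z => ?_
  rw [ContinuousMap.tendsto_iff_forall_isCompact_tendstoUniformlyOn] at hlim
  obtain ⟨M, hM⟩ := (isCompact_closedBall z 1).exists_bound_of_continuousOn f.continuous.continuousOn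
  refine differentiableAt_of_tendsto_of_bounded (M := M + 1) hF ?_ fun w =>
    (hlim {w} isCompact_singleton).tendsto_at rfl
  filter_upwards [Metric.tendstoUniformlyOn_iff.1 (hlim _ (isCompact_closedBall z 1)) 1 one_pos]
    with n hn w hw
  have h1 := hn w (ball_subset_closedBall hw)
  have h2 := hM w (ball_subset_closedBall hw)
  rw [dist_eq_norm'] at h1
  linarith [norm_le_insert' (F n w) (f w)]

instance : BaireSpace (Entire d) := by
  have : CompleteSpace (Entire d) := (isClosed_entire d).completeSpace_coe
  have : (uniformity (Entire d)).IsCountablyGenerated := by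
    rw [uniformity_subtype]
    infer_instance
  let _ := UniformSpace.pseudoMetricSpace (Entire d)
  infer_instance

instance : ContinuousAdd (Entire d) := ⟨Continuous.subtype_mk (by fun_prop) _⟩

instance : ContinuousSub (Entire d) := ⟨Continuous.subtype_mk (by fun_prop) _⟩

/-- Compact sets lie in balls of integer radius, so the sup-norms over such balls generate the
topology. -/
theorem exists_closedBall_of_mem_nhds_zero {U : Set (Entire d)} (hU : U ∈ 𝓝 0) :
    ∃ k : ℕ, ∃ ε > 0, ∀ f : Entire d, (∀ z ∈ closedBall 0 (k : ℝ), ‖f.1 z‖ ≤ ε) → f ∈ U := by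
  rw [nhds_subtype_eq_comap, mem_comap] at hU
  obtain ⟨V, hV, hVU⟩ := hU
  obtain ⟨⟨K, ε⟩, ⟨hK, hε⟩, hKV⟩ :=
    (nhds_basis_uniformity' (Metric.uniformity_basis_dist.compactConvergenceUniformity
      (α := EuclideanSpace ℂ (Fin d)))).mem_iff.1 hV
  obtain ⟨r, hr⟩ := hK.isBounded.subset_closedBall 0
  obtain ⟨k, hk⟩ := exists_nat_ge r
  refine ⟨k, ε / 2, half_pos hε, fun f hf => hVU (hKV ?_)⟩
  intro z hz
  have := hf z (closedBall_subset_closedBall hk (hr hz))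
  change dist (0 : ℂ) (f.1 z) < ε
  rw [dist_zero_left]
  linarith [half_lt_self hε]

theorem setOf_norm_sub_le_mem_nhds (f : Entire d) (k : ℝ) {η : ℝ} (hη : 0 < η) :
    {g : Entire d | ∀ z ∈ closedBall 0 k, ‖f.1 z - g.1 z‖ ≤ η} ∈ 𝓝 f := by
  rw [nhds_subtype_eq_comap, mem_comap]
  refine ⟨_, (nhds_basis_uniformity' (Metric.uniformity_basis_dist.compactConvergenceUniformity
      (α := EuclideanSpace ℂ (Fin d)))).mem_of_mem (i := (closedBall 0 k, η))
      ⟨isCompact_closedBall _ _, hη⟩, fun g hg z hz => ?_⟩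
  have : dist (f.1 z) (g.1 z) < η := hg z hz
  rw [dist_eq_norm] at this
  exact this.le

/-! ### Expansions, coefficients and partial sums -/

theorem HasExpansion.add {φ : ℕ → Fn d} {c c' : ℕ → ℂ} {f f' : Fn d} (h : HasExpansion φ c f)
    (h' : HasExpansion φ c' f') : HasExpansion φ (c + c') (f + f') := fun K hK => by
  refine ((h K hK).add (h' K hK)).congr (Eventually.of_forall fun N z _ => ?_)
  simp [add_mul, Finset.sum_add_distrib]

theorem HasExpansion.smul {φ : ℕ → Fn d} {c : ℕ → ℂ} {f : Fn d} (a : ℂ)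
    (h : HasExpansion φ c f) : HasExpansion φ (a • c) (a • f) := fun K hK => by
  refine ((uniformContinuous_const_smul a).comp_tendstoUniformlyOn (h K hK)).congr
    (Eventually.of_forall fun N z _ => ?_)
  simp [Finset.mul_sum, mul_assoc]

theorem hasExpansion_single (φ : ℕ → Fn d) (n : ℕ) : HasExpansion φ (Pi.single n 1) (φ n) :=
  fun K _ => by
  rw [Metric.tendstoUniformlyOn_iff]
  intro ε hε
  filter_upwards [eventually_gt_atTop n] with N hN z _
  rw [Finset.sum_eq_single n (by simp +contextual) (by simp; omega)]
  simpa using hε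

theorem IsBasis.eq_of_hasExpansion {φ : ℕ → Fn d} (hφ : IsBasis φ) {f : Fn d} {c c' : ℕ → ℂ}
    (hf : IsEntire f) (h : HasExpansion φ c f) (h' : HasExpansion φ c' f) : c = c' :=
  (hφ.existsUnique_expansion f hf).unique h h'

/-- The coefficient map of a basis. -/
noncomputable def IsBasis.coeff {φ : ℕ → Fn d} (hφ : IsBasis φ) : Entire d →ₗ[ℂ] ℕ → ℂ where
  toFun f := (hφ.existsUnique_expansion f.1 f.2).choose
  map_add' f g := hφ.eq_of_hasExpansion (f + g).2
    (hφ.existsUnique_expansion (f + g).1 (f + g).2).choose_spec.1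
    ((hφ.existsUnique_expansion f.1 f.2).choose_spec.1.add
      (hφ.existsUnique_expansion g.1 g.2).choose_spec.1)
  map_smul' a f := hφ.eq_of_hasExpansion (a • f).2
    (hφ.existsUnique_expansion (a • f).1 (a • f).2).choose_spec.1
    ((hφ.existsUnique_expansion f.1 f.2).choose_spec.1.smul a)

theorem IsBasis.hasExpansion_coeff {φ : ℕ → Fn d} (hφ : IsBasis φ) (f : Entire d) :
    HasExpansion φ (hφ.coeff f) f.1 :=
  (hφ.existsUnique_expansion f.1 f.2).choose_spec.1

theorem IsBasis.coeff_eq {φ : ℕ → Fn d} (hφ : IsBasis φ) {f : Entire d} {c : ℕ → ℂ}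
    (h : HasExpansion φ c f.1) : hφ.coeff f = c :=
  hφ.eq_of_hasExpansion f.2 (hφ.hasExpansion_coeff f) h

theorem IsBasis.coeff_toEntire {φ : ℕ → Fn d} (hφ : IsBasis φ) (n : ℕ) :
    hφ.coeff (hφ.entire n).toEntire = Pi.single n 1 :=
  hφ.coeff_eq (hasExpansion_single φ n)

/-- Otherwise the zero function would have two expansions. -/
theorem IsBasis.exists_ne_zero {φ : ℕ → Fn d} (hφ : IsBasis φ) (n : ℕ) : ∃ z, φ n z ≠ 0 := by
  by_contra! h
  have h0 : (hφ.entire n).toEntire = 0 := by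
    ext z
    exact h z
  have := hφ.coeff_toEntire n
  rw [h0, map_zero] at this
  simpa using congrFun this n

/-- Partial sums of the expansion of an entire function in a basis. -/
noncomputable def IsBasis.partialSum {φ : ℕ → Fn d} (hφ : IsBasis φ) (N : ℕ) :
    Entire d →ₗ[ℂ] Entire d :=
  ∑ n ∈ Finset.range N,
    ((LinearMap.proj n).comp hφ.coeff).smulRight (hφ.entire n).toEntire

theorem IsBasis.partialSum_apply {φ : ℕ → Fn d} (hφ : IsBasis φ) (N : ℕ) (f : Entire d)
    (z : EuclideanSpace ℂ (Fin d)) :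
    (hφ.partialSum N f).1 z = ∑ n ∈ Finset.range N, hφ.coeff f n * φ n z := by
  simp [partialSum, LinearMap.sum_apply, IsEntire.toEntire]

/-- All partial sums of `f` are bounded by `b` on the ball of radius `k`. -/
def IsBasis.PartialSumsBounded {φ : ℕ → Fn d} (hφ : IsBasis φ) (k : ℝ) (b : ℝ) (f : Entire d) :
    Prop :=
  ∀ N, ∀ z ∈ closedBall 0 k, ‖(hφ.partialSum N f).1 z‖ ≤ b

theorem IsBasis.PartialSumsBounded.smul {φ : ℕ → Fn d} {hφ : IsBasis φ} {k b : ℝ} {f : Entire d}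
    (h : hφ.PartialSumsBounded k b f) (a : ℂ) : hφ.PartialSumsBounded k (‖a‖ * b) (a • f) := by
  intro N z hz
  rw [map_smul]
  change ‖a * _‖ ≤ _
  rw [norm_mul]
  gcongr
  exact h N z hz

theorem IsBasis.PartialSumsBounded.sub {φ : ℕ → Fn d} {hφ : IsBasis φ} {k b b' : ℝ}
    {f g : Entire d} (h : hφ.PartialSumsBounded k b f) (h' : hφ.PartialSumsBounded k b' g) :
    hφ.PartialSumsBounded k (b + b') (f - g) := by
  intro N z hz
  have hfg : f - g = f + (-1 : ℂ) • g := by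
    ext z
    change f.1 z - g.1 z = f.1 z + (-1) * g.1 z
    ring
  rw [hfg, map_add, map_smul]
  change ‖(hφ.partialSum N f).1 z + (-1) * (hφ.partialSum N g).1 z‖ ≤ _
  rw [neg_one_mul, ← sub_eq_add_neg]
  exact (norm_sub_le _ _).trans (add_le_add (h N z hz) (h' N z hz))

theorem IsBasis.tendsto_partialSum {φ : ℕ → Fn d} (hφ : IsBasis φ) (f : Entire d) :
    Tendsto (fun N => (hφ.partialSum N f).1) atTop (𝓝 f.1) := by
  rw [ContinuousMap.tendsto_iff_forall_isCompact_tendstoUniformlyOn]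
  intro K hK
  simpa only [hφ.partialSum_apply] using hφ.hasExpansion_coeff f K hK

theorem IsBasis.exists_partialSumsBounded {φ : ℕ → Fn d} (hφ : IsBasis φ) (k : ℝ)
    (f : Entire d) : ∃ b, hφ.PartialSumsBounded k b f := by
  have hK : IsCompact (closedBall (0 : EuclideanSpace ℂ (Fin d)) k) := isCompact_closedBall _ _
  have : CompactSpace (closedBall (0 : EuclideanSpace ℂ (Fin d)) k) :=
    isCompact_iff_compactSpace.1 hK
  have hlim := ((ContinuousMap.continuous_restrict
    (closedBall (0 : EuclideanSpace ℂ (Fin d)) k)).tendsto f.1).comp (hφ.tendsto_partialSum f)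
  obtain ⟨b, hb⟩ := hlim.norm.bddAbove_range
  refine ⟨b, fun N z hz => ?_⟩
  refine le_trans ?_ (hb ⟨N, rfl⟩)
  exact ContinuousMap.norm_coe_le_norm
    ((hφ.partialSum N f).1.restrict (closedBall (0 : EuclideanSpace ℂ (Fin d)) k)) ⟨z, hz⟩

/-! ### Equicontinuity of the partial sum operators -/

/-- Baire category step: functions small on a large ball are approximable by functions with small
partial sums. -/
theorem IsBasis.exists_approx {φ : ℕ → Fn d} (hφ : IsBasis φ) (k : ℝ) :
    ∃ a : ℕ, ∃ C > 0, ∀ f : Entire d, ∀ b > 0, (∀ z ∈ closedBall 0 (a : ℝ), ‖f.1 z‖ ≤ b) →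
      ∀ j : ℝ, ∀ η > 0, ∃ g : Entire d, hφ.PartialSumsBounded k (C * b) g ∧
        ∀ z ∈ closedBall 0 j, ‖f.1 z - g.1 z‖ ≤ η := by
  -- Closures are taken because continuity of the partial sums, which would make these sets closed,
  -- is not yet known.
  obtain ⟨m, x, hx⟩ := nonempty_interior_of_iUnion_of_closed
    (f := fun m : ℕ => closure {f : Entire d | hφ.PartialSumsBounded k m f})
    (fun _ => isClosed_closure) <| Set.eq_univ_of_forall fun f => by
      obtain ⟨b, hb⟩ := hφ.exists_partialSumsBounded k f
      obtain ⟨m, hm⟩ := exists_nat_ge b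
      exact Set.mem_iUnion.2 ⟨m, subset_closure fun N z hz => (hb N z hz).trans hm⟩
  -- Differences move the interior point `x` to `0` at the price of doubling the bound.
  have hU : closure {f : Entire d | hφ.PartialSumsBounded k (m + m) f} ∈ 𝓝 (0 : Entire d) := by
    have h1 : Tendsto (fun y : Entire d => y + x) (𝓝 0) (𝓝 x) := by
      have : Continuous fun y : Entire d => y + x := by fun_prop
      simpa using this.tendsto 0
    filter_upwards [h1 (mem_interior_iff_mem_nhds.1 hx)] with y hy
    have := map_mem_closure₂ (u := {f : Entire d | hφ.PartialSumsBounded k (m + m) f})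
      continuous_sub hy (interior_subset hx) (fun f hf g hg => IsBasis.PartialSumsBounded.sub hf hg)
    have hyx : y + x - x = y := by
      ext z
      exact add_sub_cancel_right (y.1 z) (x.1 z)
    change y + x - x ∈ _ at this
    rwa [hyx] at this
  obtain ⟨a, ε, hε, ha⟩ := exists_closedBall_of_mem_nhds_zero hU
  -- The extra `1` keeps the constant positive when `m = 0`.
  refine ⟨a, (m + m + 1) / ε, by positivity, fun f b hb hf j η hη => ?_⟩
  have hmem : ((ε / b : ℝ) : ℂ) • f ∈ closure {f | hφ.PartialSumsBounded k (m + m) f} := by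
    refine ha _ fun z hz => ?_
    change ‖((ε / b : ℝ) : ℂ) * f.1 z‖ ≤ ε
    rw [norm_mul, Complex.norm_of_nonneg (by positivity)]
    calc ε / b * ‖f.1 z‖ ≤ ε / b * b := by gcongr; exact hf z hz
      _ = ε := by field_simp
  obtain ⟨g, hg1, hg2⟩ := mem_closure_iff_nhds.1 hmem _
    (setOf_norm_sub_le_mem_nhds _ j (η := ε / b * η) (by positivity))
  refine ⟨((b / ε : ℝ) : ℂ) • g, fun N z hz => ?_, fun z hz => ?_⟩
  · refine (IsBasis.PartialSumsBounded.smul hg2 _ N z hz).trans ?_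
    rw [Complex.norm_of_nonneg (by positivity)]
    rw [div_mul_eq_mul_div, div_mul_eq_mul_div, mul_comm b]
    exact div_le_div_of_nonneg_right (mul_le_mul_of_nonneg_right (by linarith) hb.le) hε.le
  · have h1 := hg1 z hz
    change ‖((ε / b : ℝ) : ℂ) * f.1 z - g.1 z‖ ≤ _ at h1
    change ‖f.1 z - ((b / ε : ℝ) : ℂ) * g.1 z‖ ≤ η
    have h2 : f.1 z - ((b / ε : ℝ) : ℂ) * g.1 z
        = ((b / ε : ℝ) : ℂ) * (((ε / b : ℝ) : ℂ) * f.1 z - g.1 z) := by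
      have : (ε : ℂ) ≠ 0 := by exact_mod_cast hε.ne'
      have : (b : ℂ) ≠ 0 := by exact_mod_cast hb.ne'
      push_cast
      field_simp
    rw [h2, norm_mul, Complex.norm_of_nonneg (by positivity)]
    calc b / ε * _ ≤ b / ε * (ε / b * η) := by gcongr
      _ = η := by field_simp

/-- Each term is the difference of two consecutive partial sums. -/
theorem IsBasis.PartialSumsBounded.norm_coeff_mul_le {φ : ℕ → Fn d} {hφ : IsBasis φ} {k b : ℝ}
    {f : Entire d} (h : hφ.PartialSumsBounded k b f) (n : ℕ) {z : EuclideanSpace ℂ (Fin d)}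
    (hz : z ∈ closedBall 0 k) : ‖hφ.coeff f n‖ * ‖φ n z‖ ≤ 2 * b := by
  have h1 := h (n + 1) z hz
  have h2 := h n z hz
  rw [hφ.partialSum_apply] at h1 h2
  rw [Finset.sum_range_succ] at h1
  rw [← norm_mul]
  linarith [norm_le_add_norm_add (hφ.coeff f n * φ n z)
    (∑ n ∈ Finset.range n, hφ.coeff f n * φ n z),
    add_comm (∑ n ∈ Finset.range n, hφ.coeff f n * φ n z) (hφ.coeff f n * φ n z) ▸ h1]

/-- The balls grow with `j` and eventually contain a point where `φ n` does not vanish; from then on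
the coefficients decay geometrically. -/
theorem IsBasis.summable_coeff {φ : ℕ → Fn d} (hφ : IsBasis φ) {g : ℕ → Entire d} {k₀ : ℕ}
    {B : ℝ} (hg : ∀ j : ℕ, hφ.PartialSumsBounded (k₀ + j) (B * (1 / 2) ^ j) (g j)) (n : ℕ) :
    Summable fun j => hφ.coeff (g j) n := by
  obtain ⟨z, hz⟩ := hφ.exists_ne_zero n
  obtain ⟨J, hJ⟩ := exists_nat_ge ‖z‖
  have hz' : 0 < ‖φ n z‖ := norm_pos_iff.2 hz
  refine Summable.of_norm_bounded_eventually_nat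
    (g := fun j => 2 * B / ‖φ n z‖ * (1 / 2 : ℝ) ^ j) (summable_geometric_two.mul_left _) ?_
  filter_upwards [eventually_ge_atTop J] with j hj
  have hzj : z ∈ closedBall (0 : EuclideanSpace ℂ (Fin d)) (k₀ + j) := by
    have h1 : (J : ℝ) ≤ j := by exact_mod_cast hj
    have h2 : (0 : ℝ) ≤ k₀ := k₀.cast_nonneg
    rw [mem_closedBall_zero_iff]
    linarith
  have := (hg j).norm_coeff_mul_le n hzj
  rw [div_mul_eq_mul_div, le_div_iff₀ hz']
  linarith

/-- Dominated convergence for series of functions, uniformly on a set. -/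
theorem tendstoUniformlyOn_tsum_of_dominated {α : Type*} {K : Set α} {F : ℕ → ℕ → α → ℂ}
    {G : ℕ → α → ℂ} {β : ℕ → ℝ} (hβ : Summable β)
    (hF : ∀ N j, ∀ z ∈ K, ‖F N j z‖ ≤ β j)
    (hlim : ∀ j, TendstoUniformlyOn (fun N => F N j) (G j) atTop K) :
    TendstoUniformlyOn (fun N z => ∑' j, F N j z) (fun z => ∑' j, G j z) atTop K := by
  have hG : ∀ j, ∀ z ∈ K, ‖G j z‖ ≤ β j := fun j z hz =>
    le_of_tendsto' ((hlim j).tendsto_at hz).norm fun N => hF N j z hz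
  -- Uniform convergence on `K` is convergence along `atTop ×ˢ 𝓟 K`, which puts dominated
  -- convergence for series at disposal.
  have key : Tendsto (fun q : ℕ × α => ∑' j, (F q.1 j q.2 - G j q.2)) (atTop ×ˢ 𝓟 K)
      (𝓝 (∑' _ : ℕ, (0 : ℂ))) := by
    refine tendsto_tsum_of_dominated_convergence (hβ.add hβ) (fun j => ?_) ?_
    · rw [Metric.tendsto_nhds]
      intro ε hε
      rw [eventually_prod_principal_iff]
      filter_upwards [Metric.tendstoUniformlyOn_iff.1 (hlim j) ε hε] with N hN z hz
      simpa [dist_eq_norm, norm_sub_rev] using hN z hz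
    · rw [eventually_prod_principal_iff]
      exact Eventually.of_forall fun N z hz j =>
        (norm_sub_le _ _).trans (add_le_add (hF N j z hz) (hG j z hz))
  rw [tsum_zero, Metric.tendsto_nhds] at key
  rw [Metric.tendstoUniformlyOn_iff]
  intro ε hε
  filter_upwards [eventually_prod_principal_iff.1 (key ε hε)] with N hN z hz
  have h1 : Summable fun j => F N j z := Summable.of_norm_bounded hβ fun j => hF N j z hz
  have h2 : Summable fun j => G j z := Summable.of_norm_bounded hβ fun j => hG j z hz
  have := hN z hz
  rwa [h1.tsum_sub h2, dist_zero_right, ← dist_eq_norm, dist_comm] at this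

/-- A pointwise convergent series of entire functions with rapidly decreasing partial sums can be
expanded term by term. -/
theorem IsBasis.partialSumsBounded_of_hasSum {φ : ℕ → Fn d} (hφ : IsBasis φ) {g : ℕ → Entire d}
    {f : Entire d} {k₀ : ℕ} {B : ℝ}
    (hg : ∀ j : ℕ, hφ.PartialSumsBounded (k₀ + j) (B * (1 / 2) ^ j) (g j))
    (hf : ∀ z, Tendsto (fun J => ∑ j ∈ Finset.range J, (g j).1 z) atTop (𝓝 (f.1 z))) :
    hφ.PartialSumsBounded k₀ (2 * B) f := by
  have hsum : ∀ (N : ℕ) (z : EuclideanSpace ℂ (Fin d)),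
      HasSum (fun j => (hφ.partialSum N (g j)).1 z)
        (∑ n ∈ Finset.range N, (∑' j, hφ.coeff (g j) n) * φ n z) := fun N z => by
    simp only [hφ.partialSum_apply]
    exact hasSum_sum fun n _ => (hφ.summable_coeff hg n).hasSum.mul_right _
  -- Interchanging the two summations expands `f` with the summed coefficients; uniqueness
  -- identifies them as those of `f`.
  have hexp : HasExpansion φ (fun n => ∑' j, hφ.coeff (g j) n) f.1 := by
    intro K hK
    obtain ⟨r, hr⟩ := hK.isBounded.subset_closedBall 0
    obtain ⟨J, hJ⟩ := exists_nat_ge r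
    choose b hb using hφ.exists_partialSumsBounded r
    -- The ball of radius `k₀ + j` is sure to contain `K` only for `j ≥ J`; the finitely many
    -- earlier terms use their own bounds.
    let β : ℕ → ℝ := fun j => if j < J then b (g j) else B * (1 / 2) ^ j
    have hβ : Summable β := by
      refine (summable_nat_add_iff J).1 ?_
      refine ((summable_nat_add_iff J).2
        (summable_geometric_two.mul_left B)).congr fun j => ?_
      simp [β]
    have hbound : ∀ N j, ∀ z ∈ K, ‖(hφ.partialSum N (g j)).1 z‖ ≤ β j := fun N j z hz => by
      simp only [β]
      split_ifs with hj
      · exact hb (g j) N z (hr hz)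
      · refine hg j N z ?_
        refine closedBall_subset_closedBall ?_ (hr hz)
        have h1 : (J : ℝ) ≤ j := by exact_mod_cast not_lt.1 hj
        have h2 : (0 : ℝ) ≤ k₀ := k₀.cast_nonneg
        linarith
    have hlim : ∀ j, TendstoUniformlyOn (fun N => (hφ.partialSum N (g j)).1) (g j).1 atTop K :=
      fun j => ContinuousMap.tendsto_iff_forall_isCompact_tendstoUniformlyOn.1
        (hφ.tendsto_partialSum (g j)) K hK
    refine ((tendstoUniformlyOn_tsum_of_dominated hβ hbound hlim).congr
      (Eventually.of_forall fun N z _ => (hsum N z).tsum_eq)).congr_right fun z hz => ?_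
    have hgz : Summable fun j => (g j).1 z := Summable.of_norm_bounded hβ fun j =>
      le_of_tendsto' ((hlim j).tendsto_at hz).norm fun N => hbound N j z hz
    exact tendsto_nhds_unique hgz.hasSum.tendsto_sum_nat (hf z)
  intro N z hz
  rw [hφ.partialSum_apply, hφ.coeff_eq hexp, ← (hsum N z).tsum_eq, mul_comm]
  refine tsum_of_norm_bounded (hasSum_geometric_two.mul_left B) fun j => hg j N z ?_
  exact closedBall_subset_closedBall (by simp) hz

/-- Partial sum operators of a basis are equicontinuous (Banach). -/
theorem IsBasis.exists_partialSumsBounded_uniform {φ : ℕ → Fn d} (hφ : IsBasis φ) (k₀ : ℕ) :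
    ∃ a : ℕ, ∃ C > 0, ∀ f : Entire d, ∀ b > 0, (∀ z ∈ closedBall 0 (a : ℝ), ‖f.1 z‖ ≤ b) →
      hφ.PartialSumsBounded k₀ (C * b) f := by
  choose a C hC happ using fun k : ℕ => hφ.exists_approx k
  refine ⟨a k₀, 2 * C k₀, mul_pos two_pos (hC _), fun f b hb hf => ?_⟩
  -- Chosen so that `C (k₀ + j) * β j = C k₀ * b / 2 ^ j`: the `j`-th correction then has
  -- geometrically small partial sums on a ball growing with `j`.
  let β : ℕ → ℝ := fun j => C k₀ * b * (1 / 2) ^ j / C (k₀ + j)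
  have hβ : ∀ j, 0 < β j := fun j => by
    have := hC (k₀ + j)
    have := hC k₀
    positivity
  -- As in the open mapping theorem, the new remainder is small enough for the next step; it is also
  -- at most `2 ^ (-j)` on the ball of radius `j`, so the remainders tend to `0` pointwise.
  have hstep : ∀ (j : ℕ) (r : Entire d), ∃ g : Entire d,
      (∀ z ∈ closedBall 0 (a (k₀ + j) : ℝ), ‖r.1 z‖ ≤ β j) →
      hφ.PartialSumsBounded (k₀ + j) (C k₀ * b * (1 / 2) ^ j) g ∧
      (∀ z ∈ closedBall 0 (a (k₀ + (j + 1)) : ℝ), ‖(r - g).1 z‖ ≤ β (j + 1)) ∧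
      ∀ z ∈ closedBall 0 (j : ℝ), ‖(r - g).1 z‖ ≤ (1 / 2) ^ j := by
    intro j r
    by_cases hr : ∀ z ∈ closedBall 0 (a (k₀ + j) : ℝ), ‖r.1 z‖ ≤ β j
    · obtain ⟨g, hg1, hg2⟩ := happ (k₀ + j) r (β j) (hβ j) hr (max (a (k₀ + (j + 1))) j)
        (min (β (j + 1)) ((1 / 2) ^ j)) (lt_min (hβ _) (by positivity))
      refine ⟨g, fun _ => ⟨?_, fun z hz => ?_, fun z hz => ?_⟩⟩
      · have : C (k₀ + j) * β j = C k₀ * b * (1 / 2) ^ j := by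
          have := (hC (k₀ + j)).ne'
          simp only [β]
          field_simp
        rw [this] at hg1
        simpa using hg1
      · exact (hg2 z (closedBall_subset_closedBall (le_max_left _ _) hz)).trans (min_le_left _ _)
      · exact (hg2 z (closedBall_subset_closedBall (le_max_right _ _) hz)).trans (min_le_right _ _)
    · exact ⟨0, fun h => (hr h).elim⟩
  choose G hG using hstep
  let r : ℕ → Entire d := fun j => Nat.rec f (fun j r => r - G j r) j
  have hr : ∀ j, ∀ z ∈ closedBall 0 (a (k₀ + j) : ℝ), ‖(r j).1 z‖ ≤ β j := by
    intro j
    induction j with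
    | zero =>
      intro z hz
      have hβ0 : β 0 = b := by
        have := (hC k₀).ne'
        simp only [β, pow_zero, mul_one, add_zero]
        field_simp
      rw [hβ0]
      exact hf z hz
    | succ j ih => exact (hG j (r j) ih).2.1
  have hrsum : ∀ J z, ∑ j ∈ Finset.range J, (G j (r j)).1 z = f.1 z - (r J).1 z := by
    intro J z
    induction J with
    | zero => simp [r]
    | succ J ih =>
      rw [Finset.sum_range_succ, ih]
      change _ = f.1 z - ((r J).1 z - (G J (r J)).1 z)
      ring
  have := hφ.partialSumsBounded_of_hasSum (f := f) (g := fun j => G j (r j)) (k₀ := k₀)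
    (B := C k₀ * b) (fun j => (hG j (r j) (hr j)).1) fun z => by
      simp only [hrsum]
      have h0 : Tendsto (fun J => (r J).1 z) atTop (𝓝 0) := by
        rw [← tendsto_add_atTop_iff_nat 1]
        obtain ⟨m, hm⟩ := exists_nat_ge ‖z‖
        refine squeeze_zero_norm' ?_ (tendsto_pow_atTop_nhds_zero_of_lt_one
          (r := (1 / 2 : ℝ)) (by norm_num) (by norm_num))
        filter_upwards [eventually_ge_atTop m] with j hj
        refine (hG j (r j) (hr j)).2.2 z ?_
        have : (m : ℝ) ≤ j := by exact_mod_cast hj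
        rw [mem_closedBall_zero_iff]
        linarith
      simpa using h0.const_sub (f.1 z)
  rwa [← mul_assoc] at this

end EntireBasis

/-! ### Summability by counting, and Borel–Carathéodory -/

/-- A bounded family whose distribution function decays geometrically is summable. -/
theorem summable_of_card_le_pow {δ : ℕ → ℝ} (h0 : ∀ n, 0 ≤ δ n) (h1 : ∀ n, δ n ≤ 1) {D : ℕ}
    (hD : 1 ≤ D) {M : ℝ} (hM : 0 ≤ M)
    (h : ∀ (L : ℕ) (F : Finset ℕ), (∀ n ∈ F, M * (1 / (2 * D : ℝ)) ^ L < δ n) → F.card ≤ D ^ L) :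
    Summable δ := by
  have hD' : (1 : ℝ) ≤ D := by exact_mod_cast hD
  have hq : 1 / (2 * D : ℝ) < 1 := by
    rw [div_lt_one (by positivity)]
    linarith
  have hlim : Tendsto (fun L : ℕ => M * (1 / (2 * D : ℝ)) ^ L) atTop (𝓝 0) := by
    simpa using (tendsto_pow_atTop_nhds_zero_of_lt_one (by positivity) hq).const_mul M
  have hex : ∀ n, ∃ L : ℕ, 0 < δ n → M * (1 / (2 * D : ℝ)) ^ L < δ n := fun n => by
    by_cases hn : 0 < δ n
    · exact ((hlim.eventually (gt_mem_nhds hn)).exists).imp fun _ h _ => h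
    · exact ⟨0, fun h => (hn h).elim⟩
  let lev : ℕ → ℕ := fun n => Nat.find (hex n)
  -- By minimality of the level, `δ` at level `L` is at most the threshold of level `L - 1`, or `1`
  -- when `L = 0`. At most `D ^ L` positive values have level `L`, and `D ^ L * u L` is eventually
  -- geometric of ratio `1 / 2`.
  let u : ℕ → ℝ := fun L => Nat.casesOn L 1 fun L => M * (1 / (2 * D : ℝ)) ^ L
  have hu0 : ∀ L, 0 ≤ u L := fun L => by
    cases L
    · exact zero_le_one
    · change 0 ≤ M * _
      positivity
  have hu : ∀ n, δ n ≤ u (lev n) := by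
    intro n
    rcases hL : lev n with _ | L
    · exact h1 n
    · have := Nat.find_min (hex n) (m := L) (by change L < lev n; omega)
      push Not at this
      exact this.2
  have hsum : Summable fun L => (D : ℝ) ^ L * u L := by
    refine (summable_nat_add_iff 1).1 ((summable_geometric_two.mul_left (D * M)).congr fun L => ?_)
    change D * M * (1 / 2) ^ L = (D : ℝ) ^ (L + 1) * (M * (1 / (2 * D : ℝ)) ^ L)
    have : (D : ℝ) * (1 / (2 * D : ℝ)) = 1 / 2 := by field_simp
    rw [← this, mul_pow]
    ring
  refine summable_of_sum_le (c := ∑' L, (D : ℝ) ^ L * u L) h0 fun F => ?_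
  -- Indices with `δ n = 0` get level `0` by default and are not counted by the hypothesis.
  let F' := F.filter fun n => 0 < δ n
  calc ∑ n ∈ F, δ n = ∑ n ∈ F', δ n :=
        (Finset.sum_filter_of_ne fun n _ hn => lt_of_le_of_ne (h0 n) hn.symm).symm
    _ ≤ ∑ n ∈ F', u (lev n) := Finset.sum_le_sum fun n _ => hu n
    _ = ∑ L ∈ F'.image lev, (F'.filter fun n => lev n = L).card • u L := Finset.sum_comp u lev
    _ ≤ ∑ L ∈ F'.image lev, (D : ℝ) ^ L * u L := by
        refine Finset.sum_le_sum fun L _ => ?_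
        rw [nsmul_eq_mul]
        refine mul_le_mul_of_nonneg_right ?_ (hu0 L)
        have : (F'.filter fun n => lev n = L).card ≤ D ^ L := by
          refine h L _ fun n hn => ?_
          rw [Finset.mem_filter, Finset.mem_filter] at hn
          rw [← hn.2]
          exact Nat.find_spec (hex n) hn.1.2
        exact_mod_cast this
    _ ≤ _ := hsum.sum_le_tsum _ fun L _ => mul_nonneg (by positivity) (hu0 L)

/-- Borel–Carathéodory estimate for entire functions of several variables. -/
theorem norm_sub_le_of_norm_le {E : Type*} [NormedAddCommGroup E] [NormedSpace ℂ E] {f : E → ℂ}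
    (hf : Differentiable ℂ f) {r S m : ℝ} (hr : 0 < r) (hrS : r < S)
    (hm : ∀ z ∈ closedBall 0 S, ‖f z‖ ≤ m) {z : E} (hz : ‖z‖ ≤ r) :
    ‖f z - f 0‖ ≤ 2 * (m - ‖f 0‖) * (r / (S - r)) := by
  have hS : 0 < S - r := sub_pos.2 hrS
  have h0 : ‖f 0‖ ≤ m := hm 0 (by simpa using (hr.trans hrS).le)
  obtain ⟨u, hu1, hu⟩ := RCLike.exists_norm_eq_mul_self (f 0)
  -- The rotation `u` makes `u * f 0 = ‖f 0‖`, so `u * (f - f 0)` has real part at most `m - ‖f 0‖`.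
  -- The one-variable estimate on the complex line through `z` needs a positive bound, hence `ε`.
  have hε : ∀ ε > 0, ‖f z - f 0‖ ≤ 2 * (m - ‖f 0‖ + ε) * (r / (S - r)) := fun ε hε => by
    have key := Complex.borelCaratheodory_zero (M := m - ‖f 0‖ + ε) (R := S / r)
      (f := fun w : ℂ => u * (f (w • z) - f 0)) (z := 1) (by linarith)
      (by fun_prop) (fun w hw => ?_) (div_pos (hr.trans hrS) hr) ?_ (by simp)
    · rw [norm_mul, hu1, one_mul, one_smul, norm_one, mul_one] at key
      refine key.trans_eq ?_
      field_simp
    · have hwz : w • z ∈ closedBall (0 : E) S := by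
        rw [mem_ball_zero_iff, lt_div_iff₀ hr] at hw
        rw [mem_closedBall_zero_iff, norm_smul]
        exact (mul_le_mul_of_nonneg_left hz (norm_nonneg w)).trans hw.le
      have h1 : (u * f (w • z)).re ≤ m := by
        refine (Complex.re_le_norm _).trans ?_
        rw [norm_mul, hu1, one_mul]
        exact hm _ hwz
      have h2 : (u * f 0).re = ‖f 0‖ := by
        rw [← hu]
        exact Complex.ofReal_re _
      change (u * (f (w • z) - f 0)).re ≤ _
      rw [mul_sub, Complex.sub_re, h2]
      linarith
    · rw [mem_ball_zero_iff, norm_one, one_lt_div hr]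
      exact hrS
  have hlim : Tendsto (fun ε : ℝ => 2 * (m - ‖f 0‖ + ε) * (r / (S - r))) (𝓝[>] 0)
      (𝓝 (2 * (m - ‖f 0‖) * (r / (S - r)))) := by
    have : Continuous fun ε : ℝ => 2 * (m - ‖f 0‖ + ε) * (r / (S - r)) := by fun_prop
    simpa using (this.tendsto 0).mono_left nhdsWithin_le_nhds
  exact ge_of_tendsto hlim (eventually_mem_nhdsWithin.mono hε)

namespace EntireBasis

variable {d : ℕ}

/-! ### Coefficient estimates and absoluteness of bases -/

theorem supOn_nonneg (K : Set (EuclideanSpace ℂ (Fin d))) (f : Fn d) : 0 ≤ supOn K f :=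
  Real.iSup_nonneg fun _ => norm_nonneg _

theorem supOn_le {K : Set (EuclideanSpace ℂ (Fin d))} {f : Fn d} {b : ℝ} (hb : 0 ≤ b)
    (h : ∀ z ∈ K, ‖f z‖ ≤ b) : supOn K f ≤ b :=
  Real.iSup_le (fun z => h z z.2) hb

theorem norm_le_supOn {K : Set (EuclideanSpace ℂ (Fin d))} (hK : IsCompact K) {f : Fn d}
    (hf : IsEntire f) {z : EuclideanSpace ℂ (Fin d)} (hz : z ∈ K) : ‖f z‖ ≤ supOn K f := by
  refine le_ciSup (f := fun z : K => ‖f z‖) ?_ ⟨z, hz⟩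
  obtain ⟨b, hb⟩ := hK.exists_bound_of_continuousOn hf.continuous.continuousOn
  exact ⟨b, by rintro _ ⟨w, rfl⟩; exact hb w w.2⟩

theorem supOn_mono {K K' : Set (EuclideanSpace ℂ (Fin d))} (hK' : IsCompact K') (h : K ⊆ K')
    {f : Fn d} (hf : IsEntire f) : supOn K f ≤ supOn K' f :=
  supOn_le (supOn_nonneg _ _) fun _ hz => norm_le_supOn hK' hf (h hz)

theorem IsBasis.exists_norm_coeff_mul_supOn_le {φ : ℕ → Fn d} (hφ : IsBasis φ) (k : ℕ) :
    ∃ a : ℕ, ∃ C > 0, ∀ (f : Entire d) (n : ℕ),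
      ‖hφ.coeff f n‖ * supOn (closedBall 0 k) (φ n) ≤ C * supOn (closedBall 0 a) f.1 := by
  obtain ⟨a, C, hC, h⟩ := hφ.exists_partialSumsBounded_uniform k
  refine ⟨a, 2 * C, by positivity, fun f n => ?_⟩
  -- Equicontinuity is stated for positive bounds, while the supremum may be `0`.
  have hε : ∀ ε > 0, ‖hφ.coeff f n‖ * supOn (closedBall 0 k) (φ n)
      ≤ 2 * (C * (supOn (closedBall 0 a) f.1 + ε)) := fun ε hε => by
    have hs := supOn_nonneg (closedBall 0 (a : ℝ)) f.1
    have hb := h f (supOn (closedBall 0 a) f.1 + ε) (by positivity) fun z hz =>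
      (norm_le_supOn (isCompact_closedBall _ _) f.2 hz).trans (by linarith)
    rw [supOn, Real.mul_iSup_of_nonneg (norm_nonneg _)]
    exact Real.iSup_le (fun z => hb.norm_coeff_mul_le n z.2) (by positivity)
  have hlim : Tendsto (fun ε : ℝ => 2 * (C * (supOn (closedBall 0 a) f.1 + ε))) (𝓝[>] 0)
      (𝓝 (2 * (C * supOn (closedBall 0 a) f.1))) := by
    have : Continuous fun ε : ℝ => 2 * (C * (supOn (closedBall 0 a) f.1 + ε)) := by fun_prop
    simpa using (this.tendsto 0).mono_left nhdsWithin_le_nhds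
  rw [mul_assoc]
  exact ge_of_tendsto hlim (eventually_mem_nhdsWithin.mono hε)

theorem IsBasis.coeff_sum_smul {φ : ℕ → Fn d} (hφ : IsBasis φ) (F : Finset ℕ) (x : ℕ → ℂ) {m : ℕ}
    (hm : m ∈ F) : hφ.coeff (∑ n ∈ F, x n • (hφ.entire n).toEntire) m = x m := by
  simp only [map_sum, map_smul, hφ.coeff_toEntire, Finset.sum_apply, Pi.smul_apply, smul_eq_mul,
    Pi.single_apply, mul_ite, mul_one, mul_zero]
  simp [hm]

theorem sum_smul_toEntire_apply {φ : ℕ → Fn d} (hφ : IsBasis φ) (F : Finset ℕ) (x : ℕ → ℂ)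
    (z : EuclideanSpace ℂ (Fin d)) :
    (∑ n ∈ F, x n • (hφ.entire n).toEntire).1 z = ∑ n ∈ F, x n * φ n z := by
  simp [IsEntire.toEntire]

/-- The ratios of the sup-norms of a basis on a ball and on a large concentric ball are summable. -/
theorem IsBasis.exists_summable_ratio {φ : ℕ → Fn d} (hφ : IsBasis φ) (R : ℕ) :
    ∃ R' : ℕ, R ≤ R' ∧
      Summable fun n => supOn (closedBall 0 (R : ℝ)) (φ n) / supOn (closedBall 0 (R' : ℝ)) (φ n) := by
  obtain ⟨a, C, hC, hcoeff⟩ := hφ.exists_norm_coeff_mul_supOn_le R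
  set D : ℕ := d + 1 with hD
  have hD1 : (1 : ℝ) ≤ D := by exact_mod_cast Nat.le_add_left 1 d
  -- This makes `a / R' ≤ ρ = 1 / (2 D ^ 2)`, so that `D * ρ = 1 / (2 D)`: after summing about `D ^
  -- L` terms, the Schwarz gain `ρ ^ L` still leaves the threshold `(1 / (2 D)) ^ L`.
  let R' : ℕ := 2 * D ^ 2 * (a + R + 1)
  have hRR' : R ≤ R' := by
    have : 1 ≤ 2 * D ^ 2 := Nat.mul_pos two_pos (by positivity)
    calc R ≤ 1 * (a + R + 1) := by omega
      _ ≤ R' := Nat.mul_le_mul_right _ this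
  have hR'pos : (0 : ℝ) < R' := by
    simp only [R']
    positivity
  set ρ : ℝ := 1 / (2 * D ^ 2) with hρ
  have hρ0 : 0 < ρ := by positivity
  have haR' : (a : ℝ) / R' ≤ ρ := by
    rw [hρ, div_le_div_iff₀ hR'pos (by positivity)]
    simp only [R']
    push_cast
    have : (0 : ℝ) ≤ R := R.cast_nonneg
    nlinarith [sq_nonneg (D : ℝ)]
  have haltR' : (a : ℝ) < R' := by
    have h1 : (a : ℝ) ≤ ρ * R' := by rwa [div_le_iff₀ hR'pos] at haR'
    have h2 : ρ < 1 := by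
      rw [hρ, div_lt_one (by positivity)]
      nlinarith
    nlinarith
  let r : ℕ → ℝ := fun n => supOn (closedBall 0 (R : ℝ)) (φ n)
  let r' : ℕ → ℝ := fun n => supOn (closedBall 0 (R' : ℝ)) (φ n)
  have hr0 : ∀ n, 0 ≤ r n := fun n => supOn_nonneg _ _
  have hr'0 : ∀ n, 0 ≤ r' n := fun n => supOn_nonneg _ _
  refine ⟨R', hRR', summable_of_card_le_pow (D := D) (M := 2 * C * ρ)
    (fun n => div_nonneg (hr0 n) (hr'0 n)) (fun n => ?_) (by omega) (by positivity) ?_⟩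
  · exact div_le_one_of_le₀ (supOn_mono (isCompact_closedBall _ _)
      (closedBall_subset_closedBall (by exact_mod_cast hRR')) (hφ.entire n)) (hr'0 n)
  intro L F hF
  by_contra! hcard
  obtain ⟨F₀, hF₀, hF₀card⟩ := Finset.exists_subset_card_eq (Nat.succ_le_of_lt hcard)
  set t : ℝ := 2 * C * ρ * (1 / (2 * D : ℝ)) ^ L with ht
  have ht0 : 0 < t := by positivity
  have hlt : ∀ n ∈ F₀, t * r' n < r n := fun n hn => by
    have h1 := hF n (hF₀ hn)
    have h2 : 0 < r' n := by
      refine lt_of_le_of_ne (hr'0 n) fun h => ?_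
      change t < r n / r' n at h1
      rw [← h, div_zero] at h1
      exact lt_asymm h1 ht0
    exact (lt_div_iff₀ h2).1 h1
  -- With `D ^ L + 1` indices a nontrivial combination vanishes to order above `L`. Its smallness on
  -- the ball of radius `a` forces `∑ ‖x m‖ * r m ≤ t * M`, whereas large ratios force the reverse
  -- strict inequality.
  obtain ⟨x, ⟨m₀, hm₀, hxm₀⟩, hx⟩ := exists_combination_small (n := L) F₀
    (by rw [hF₀card]; exact Nat.lt_succ_self _)
    fun n => (hφ.entire n).toEntire
  set g := ∑ m ∈ F₀, x m • (hφ.entire m).toEntire with hg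
  set M : ℝ := ∑ m ∈ F₀, ‖x m‖ * r' m with hM
  have hM0 : 0 ≤ M := Finset.sum_nonneg fun m _ => mul_nonneg (norm_nonneg _) (hr'0 m)
  have hgM : ∀ z ∈ closedBall 0 (R' : ℝ), ‖g.1 z‖ ≤ M := fun z hz => by
    rw [hg, sum_smul_toEntire_apply hφ]
    refine norm_sum_le_of_le _ fun m _ => ?_
    rw [norm_mul]
    exact mul_le_mul_of_nonneg_left
      (norm_le_supOn (isCompact_closedBall _ _) (hφ.entire m) hz) (norm_nonneg _)
  have hgsmall : supOn (closedBall 0 (a : ℝ)) g.1 ≤ M * ρ ^ (L + 1) :=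
    supOn_le (by positivity) fun z hz => by
      rw [mem_closedBall_zero_iff] at hz
      refine (hx R' M hgM z (hz.trans_lt haltR')).trans ?_
      gcongr
      exact (div_le_div_of_nonneg_right hz hR'pos.le).trans haR'
  have hterm : ∀ m ∈ F₀, ‖x m‖ * r m ≤ C * (M * ρ ^ (L + 1)) := fun m hm => by
    have := hcoeff g m
    rw [hg, hφ.coeff_sum_smul F₀ x hm] at this
    exact this.trans (mul_le_mul_of_nonneg_left hgsmall hC.le)
  have hlow : t * M < ∑ m ∈ F₀, ‖x m‖ * r m := by
    rw [hM, Finset.mul_sum]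
    refine Finset.sum_lt_sum (fun m hm => ?_) ⟨m₀, hm₀, ?_⟩
    · rw [mul_left_comm]
      exact mul_le_mul_of_nonneg_left (hlt m hm).le (norm_nonneg _)
    · rw [mul_left_comm]
      exact mul_lt_mul_of_pos_left (hlt m₀ hm₀) (norm_pos_iff.2 hxm₀)
  have hup := Finset.sum_le_card_nsmul F₀ _ _ hterm
  rw [hF₀card, nsmul_eq_mul] at hup
  refine absurd (hlow.trans_le hup) (not_lt.2 ?_)
  have h1 : ((D ^ L).succ : ℝ) ≤ 2 * (D : ℝ) ^ L := by
    push_cast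
    linarith [one_le_pow₀ hD1 (n := L)]
  have h2 : (D : ℝ) * ρ = 1 / (2 * D) := by
    rw [hρ]
    field_simp
  calc ((D ^ L).succ : ℝ) * (C * (M * ρ ^ (L + 1)))
      ≤ 2 * (D : ℝ) ^ L * (C * (M * ρ ^ (L + 1))) := by gcongr
    _ = t * M := by
        rw [ht, ← h2, mul_pow]
        ring

/-- Every basis of `H(ℂ^d)` is absolute (Dynin–Mityagin). -/
theorem IsBasis.exists_summable_tsum_le {φ : ℕ → Fn d} (hφ : IsBasis φ) (R : ℕ) :
    ∃ a : ℕ, ∃ C > 0, ∀ f : Entire d,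
      Summable (fun n => ‖hφ.coeff f n‖ * supOn (closedBall 0 (R : ℝ)) (φ n)) ∧
        ∑' n, ‖hφ.coeff f n‖ * supOn (closedBall 0 (R : ℝ)) (φ n)
          ≤ C * supOn (closedBall 0 (a : ℝ)) f.1 := by
  obtain ⟨R', hRR', hsum⟩ := hφ.exists_summable_ratio R
  obtain ⟨a, C, hC, hcoeff⟩ := hφ.exists_norm_coeff_mul_supOn_le R'
  set δ : ℕ → ℝ := fun n =>
    supOn (closedBall 0 (R : ℝ)) (φ n) / supOn (closedBall 0 (R' : ℝ)) (φ n) with hδ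
  have hδ0 : ∀ n, 0 ≤ δ n := fun n => div_nonneg (supOn_nonneg _ _) (supOn_nonneg _ _)
  have htsum : 0 ≤ ∑' n, δ n := tsum_nonneg hδ0
  refine ⟨a, ((∑' n, δ n) + 1) * C, by positivity, fun f => ?_⟩
  set s := supOn (closedBall 0 (a : ℝ)) f.1 with hs
  have hs0 : 0 ≤ s := supOn_nonneg _ _
  have hle : ∀ n, ‖hφ.coeff f n‖ * supOn (closedBall 0 (R : ℝ)) (φ n) ≤ δ n * (C * s) := by
    intro n
    have hmono : supOn (closedBall 0 (R : ℝ)) (φ n) ≤ supOn (closedBall 0 (R' : ℝ)) (φ n) :=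
      supOn_mono (isCompact_closedBall _ _)
        (closedBall_subset_closedBall (by exact_mod_cast hRR')) (hφ.entire n)
    -- A zero denominator is harmless: the norm on the smaller ball then vanishes too.
    have heq : supOn (closedBall 0 (R : ℝ)) (φ n)
        = δ n * supOn (closedBall 0 (R' : ℝ)) (φ n) := by
      rcases eq_or_ne (supOn (closedBall 0 (R' : ℝ)) (φ n)) 0 with h | h
      · rw [h, mul_zero]
        exact le_antisymm (h ▸ hmono) (supOn_nonneg _ _)
      · rw [hδ]
        exact (div_mul_cancel₀ _ h).symm
    rw [heq, mul_left_comm]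
    exact mul_le_mul_of_nonneg_left (hcoeff f n) (hδ0 n)
  have hsum' := hsum.mul_right (C * s)
  have hsummable := Summable.of_nonneg_of_le
    (fun n => mul_nonneg (norm_nonneg _) (supOn_nonneg _ _)) hle hsum'
  refine ⟨hsummable, (hsummable.tsum_le_tsum hle hsum').trans ?_⟩
  rw [tsum_mul_right, mul_assoc]
  have : 0 ≤ C * s := by positivity
  nlinarith

/-! ### The two implications -/

theorem IsBasis.globalBohrProperty_of_const {φ : ℕ → Fn d} (hφ : IsBasis φ) {n₀ : ℕ} {a : ℂ}
    (ha : ∀ z, φ n₀ z = a) : GlobalBohrProperty φ := by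
  intro K hK
  have ha0 : a ≠ 0 := by
    obtain ⟨z, hz⟩ := hφ.exists_ne_zero n₀
    rwa [ha z] at hz
  obtain ⟨R₀, hR₀⟩ := hK.isBounded.subset_closedBall 0
  obtain ⟨R, hR⟩ := exists_nat_ge R₀
  have hKR : K ⊆ closedBall 0 (R : ℝ) := hR₀.trans (closedBall_subset_closedBall hR)
  obtain ⟨b, C, hC, hDM⟩ := hφ.exists_summable_tsum_le R
  set r : ℝ := b + 1 with hr
  have hr0 : 0 < r := by positivity
  -- Large enough that the Borel–Carathéodory factor `2 r / (S - r)` is at most `1 / C`, and that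
  -- the ball contains `K`.
  set S : ℝ := r * (1 + 2 * C) + R with hS
  have hSr : 2 * C * r ≤ S - r := by
    have : (0 : ℝ) ≤ R := R.cast_nonneg
    rw [hS]
    linarith
  have hCr : 0 < 2 * C * r := by positivity
  refine ⟨closedBall 0 S, isCompact_closedBall _ _,
    hKR.trans (closedBall_subset_closedBall (by linarith)), fun f c hf hc => ?_⟩
  set m := supOn (closedBall 0 S) f with hm
  have hfm : ∀ z ∈ closedBall 0 S, ‖f z‖ ≤ m := fun z hz =>
    norm_le_supOn (isCompact_closedBall _ _) hf hz
  have hfm0 : ‖f 0‖ ≤ m := hfm 0 (by rw [mem_closedBall_zero_iff, norm_zero]; linarith)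
  let f' : Entire d := hf.toEntire + (-(f 0 / a)) • (hφ.entire n₀).toEntire
  have hf' : ∀ z, f'.1 z = f z - f 0 := fun z => by
    change f z + (-(f 0 / a)) * φ n₀ z = _
    rw [ha z]
    field_simp
    ring
  have hcoeff : hφ.coeff f' = c + (-(f 0 / a)) • Pi.single n₀ 1 := by
    rw [map_add, map_smul, hφ.coeff_toEntire, hφ.coeff_eq (f := hf.toEntire) hc]
  obtain ⟨hsum, htsum⟩ := hDM f'
  have hsup : supOn (closedBall 0 (b : ℝ)) f'.1 ≤ (m - ‖f 0‖) / C := by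
    have hm0 : 0 ≤ m - ‖f 0‖ := sub_nonneg.2 hfm0
    refine supOn_le (by positivity) fun z hz => ?_
    rw [mem_closedBall_zero_iff] at hz
    rw [hf']
    refine (norm_sub_le_of_norm_le hf hr0 (by linarith) hfm (z := z) (by linarith)).trans ?_
    have : r / (S - r) ≤ 1 / (2 * C) := by
      rw [div_le_div_iff₀ (by linarith) (by positivity)]
      linarith
    calc 2 * (m - ‖f 0‖) * (r / (S - r)) ≤ 2 * (m - ‖f 0‖) * (1 / (2 * C)) := by gcongr
      _ = (m - ‖f 0‖) / C := by field_simp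
  -- The cost of passing from the coefficients of `f - f 0` back to those of `f`.
  let e : ℕ → ℝ := Pi.single n₀ ‖f 0‖
  have he : HasSum e ‖f 0‖ := hasSum_pi_single n₀ _
  have hle : ∀ n, ‖c n‖ * supOn K (φ n)
      ≤ ‖hφ.coeff f' n‖ * supOn (closedBall 0 (R : ℝ)) (φ n) + e n := by
    intro n
    have hmono : supOn K (φ n) ≤ supOn (closedBall 0 (R : ℝ)) (φ n) :=
      supOn_mono (isCompact_closedBall _ _) hKR (hφ.entire n)
    rw [hcoeff]
    rcases eq_or_ne n n₀ with rfl | hn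
    · have hsupa : supOn (closedBall 0 (R : ℝ)) (φ n) ≤ ‖a‖ :=
        supOn_le (norm_nonneg _) fun z _ => by rw [ha z]
      have h0 := supOn_nonneg (closedBall 0 (R : ℝ)) (φ n)
      have hcn : ‖c n‖ ≤ ‖c n + -(f 0 / a)‖ + ‖f 0 / a‖ := by
        simpa using norm_add_le (c n + -(f 0 / a)) (f 0 / a)
      have hfa : ‖f 0 / a‖ * supOn (closedBall 0 (R : ℝ)) (φ n) ≤ ‖f 0‖ := by
        refine (mul_le_mul_of_nonneg_left hsupa (norm_nonneg _)).trans_eq ?_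
        rw [← norm_mul, div_mul_cancel₀ _ ha0]
      simp only [Pi.add_apply, Pi.smul_apply, Pi.single_eq_same, smul_eq_mul, mul_one, e]
      calc ‖c n‖ * supOn K (φ n) ≤ ‖c n‖ * supOn (closedBall 0 (R : ℝ)) (φ n) := by gcongr
        _ ≤ (‖c n + -(f 0 / a)‖ + ‖f 0 / a‖) * supOn (closedBall 0 (R : ℝ)) (φ n) := by gcongr
        _ ≤ _ := by rw [add_mul]; gcongr
    · simp only [Pi.add_apply, Pi.smul_apply, Pi.single_eq_of_ne hn, smul_zero, add_zero, e]
      gcongr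
  have hsummable := Summable.of_nonneg_of_le
    (fun n => mul_nonneg (norm_nonneg _) (supOn_nonneg _ _)) hle (hsum.add he.summable)
  refine ⟨hsummable, (hsummable.tsum_le_tsum hle (hsum.add he.summable)).trans ?_⟩
  rw [hsum.tsum_add he.summable, he.tsum_eq]
  calc _ ≤ C * ((m - ‖f 0‖) / C) + ‖f 0‖ := by
        gcongr
        exact htsum.trans (by gcongr)
    _ = m := by field_simp; ring

theorem IsBasis.exists_const_of_globalBohrProperty {φ : ℕ → Fn d} (hφ : IsBasis φ)
    (h : GlobalBohrProperty φ) : ∃ n : ℕ, ∃ a : ℂ, ∀ z, φ n z = a := by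
  have h1 : IsEntire (fun _ : EuclideanSpace ℂ (Fin d) => (1 : ℂ)) := differentiable_const 1
  obtain ⟨c, hc, -⟩ := hφ.existsUnique_expansion _ h1
  -- The index is fixed before `z`, so one `φ n` serves all points.
  obtain ⟨n, hn⟩ : ∃ n, c n ≠ 0 := by
    by_contra! h0
    have := (hc {0} isCompact_singleton).tendsto_at (Set.mem_singleton 0)
    simp only [h0, zero_mul, Finset.sum_const_zero] at this
    exact zero_ne_one (tendsto_nhds_unique tendsto_const_nhds this)
  refine ⟨n, φ n 0, fun z => mul_left_cancel₀ hn ?_⟩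
  have hK : IsCompact ({0, z} : Set (EuclideanSpace ℂ (Fin d))) := (Set.toFinite _).isCompact
  set K : Set (EuclideanSpace ℂ (Fin d)) := {0, z} with hKdef
  obtain ⟨K₁, -, -, hK₁⟩ := h K hK
  obtain ⟨hsum, htsum⟩ := hK₁ _ c h1 hc
  have hle1 : ∑' n, ‖c n‖ * supOn K (φ n) ≤ 1 :=
    htsum.trans (supOn_le zero_le_one fun _ _ => by simp)
  -- The numbers `‖c k‖ * supOn K (φ k) - Re (c k * φ k w)` are nonnegative with sum at most `1 -
  -- 1`, so all vanish. Hence `c n * φ n w` equals its bound, which does not depend on `w`.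
  have key : ∀ w ∈ K, c n * φ n w = ((‖c n‖ * supOn K (φ n) : ℝ) : ℂ) := by
    intro w hw
    have hterm : ∀ k, ‖c k * φ k w‖ ≤ ‖c k‖ * supOn K (φ k) := fun k => by
      rw [norm_mul]
      exact mul_le_mul_of_nonneg_left (norm_le_supOn hK (hφ.entire k) hw) (norm_nonneg _)
    have hs : HasSum (fun k => c k * φ k w) 1 := by
      have hsw : Summable fun k => c k * φ k w := Summable.of_norm_bounded hsum hterm
      have := tendsto_nhds_unique hsw.hasSum.tendsto_sum_nat ((hc K hK).tendsto_at hw)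
      rw [← this]
      exact hsw.hasSum
    have hdiff := hsum.hasSum.sub (Complex.hasSum_re hs)
    have h2 := le_hasSum hdiff n fun k _ =>
      sub_nonneg.2 ((Complex.re_le_norm _).trans (hterm k))
    rw [Complex.one_re] at h2
    have hre : (c n * φ n w).re = ‖c n‖ * supOn K (φ n) :=
      le_antisymm ((Complex.re_le_norm _).trans (hterm n)) (by linarith)
    have hnorm : (c n * φ n w).re = ‖c n * φ n w‖ :=
      le_antisymm (Complex.re_le_norm _) (by rw [hre]; exact hterm n)
    have him : (c n * φ n w).im = 0 := (Complex.nonneg_iff.1 (Complex.re_eq_norm.1 hnorm)).2.symm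
    exact Complex.ext (by rw [hre, Complex.ofReal_re]) (by rw [him, Complex.ofReal_im])
  rw [key z (by simp [hKdef]), key 0 (by simp [hKdef])]

end EntireBasis

theorem theorem3p1 (d : ℕ) (hd : 1 ≤ d) (φ : ℕ → EntireBasis.Fn d)
    (hφ : EntireBasis.IsBasis φ) :
    EntireBasis.GlobalBohrProperty φ ↔
      ∃ n : ℕ, ∃ a : ℂ, ∀ z : EuclideanSpace ℂ (Fin d), φ n z = a :=
  ⟨hφ.exists_const_of_globalBohrProperty, fun ⟨_, _, ha⟩ => hφ.globalBohrProperty_of_const ha⟩
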